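/- Notation. $\mathbb D$ is the open unit disc, $\mathbb T=\partial\mathbb D$, and $\mathcal L_{\mathbb T}$ is the arc length measure on $\mathbb T$ (total mass $2\pi$). For $z,w\in\mathbb C^n$ put $z\bullet w=\sum_j z_jw_j$; real parts of vectors are taken coordinatewise. A convex tube is a set $D=\Omega+i\mathbb R^n\subset\mathbb C^n$ with $\Omega\subset\mathbb R^n$ a convex domain; $\operatorname{Re}D:=\Omega$ is its base. $D$ is taut if the family $\mathcal O(\mathbb D,D)$ is normal (every sequence has a subsequence which either converges locally uniformly to an element of $\mathcal O(\mathbb D,D)$ or is compactly divergent). A complex geodesic for $D$ is a holomorphic map $\varphi:\mathbb D\to D$ which is an isometry for the Poincaré distance on $\mathbb D$ and the Carathéodory (pseudo)distance on $D$. An $n$-tuple $\mu=(\mu_1,\dots,\mu_n)$ of finite real Borel measures on $\mathbb T$ is the boundary measure of $\varphi=(\varphi_1,\dots,\varphi_n)$ if for each $j$ there is $\alpha_j\in\mathbb R$ with $$\varphi_j(\lambda)=\frac1{2\pi}\int_{\mathbb T}\frac{\zeta+\lambda}{\zeta-\lambda}\,d\mu_j(\zeta)+i\alpha_j,\qquad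 \lambda\in\mathbb D.$$ The radial limit of $\varphi$ at $\lambda\in\mathbb T$ is $\varphi^*(\lambda)=\lim_{r\to1^-}\varphi(r\lambda)$, if it exists. Lemma. Let $D\subset\mathbb C^n$ be a taut convex tube, let $p\in\partial\operatorname{Re}D$, and put $$V:=\{v\in\mathbb R^n:\langle\operatorname{Re}z-p,v\rangle<0\text{ for all }z\in D\}.$$ Let $\varphi:\mathbb D\to D$ be a complex geodesic for $D$ with the boundary measure $\mu$. Let $h:\mathbb C\to\mathbb C^n$, $h\not\equiv0$, be a map of the form $h(\lambda)=\bar a\lambda^2+b\lambda+a$ with $a\in\mathbb C^n$, $b\in\mathbb R^n$ (so that $\bar\lambda h(\lambda)\in\mathbb R^n$ for $\lambda\in\mathbb T$), such that for every $z\in D$ the real measure $$\bar\lambda h(\lambda)\bullet\bigl(\operatorname{Re}z\,d\mathcal L_{\mathbb T}(\lambda)-d\mu(\lambda)\bigr)$$ on $\mathbb T$ is negative (i.e. $\le 0$). Put $A:=\{\lambda\in\mathbb T:\bar\lambda h(\lambda)\in\operatorname{int}V\}$. Then $A$ is a Borel set, $$\chi_A\,d\mu=p\,\chi_A\,d\mathcal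 L_{\mathbb T},$$ and for every $\lambda\in A$ the radial limit $\varphi^*(\lambda)$ exists and $\operatorname{Re}\varphi^*(\lambda)=p$. -/

import Mathlib

open MeasureTheory Filter Topology Set

noncomputable section

namespace TubeGeodesic

/-! ### The unit circle -/

instance instMeasurableSpaceCircle : MeasurableSpace Circle := borel Circle

instance instBorelSpaceCircle : BorelSpace Circle := ⟨rfl⟩

/-- Lebesgue (arc length) measure on the unit circle, of total mass `2π`: the image of Lebesgue
measure on `(-π, π]` under `t ↦ exp (i t)`. -/
def circleLebesgue : Measure Circle :=
  Measure.map Circle.exp (volume.restrict (Ioc (-Real.pi) Real.pi))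

instance instIsFiniteMeasureCircleLebesgue : IsFiniteMeasure circleLebesgue := by
  unfold circleLebesgue
  infer_instance

/-- Arc length measure on the unit circle, as a real (signed) measure. -/
def circleLebesgueSigned : SignedMeasure Circle := circleLebesgue.toSignedMeasure

/-! ### Convex tube domains -/

/-- The coordinatewise real part of a vector of `ℂⁿ`. -/
def reVec {n : ℕ} (z : Fin n → ℂ) : Fin n → ℝ := fun j => (z j).re

/-- `D = Ω + i ℝⁿ` for some convex domain `Ω ⊆ ℝⁿ`. -/
def IsConvexTube {n : ℕ} (D : Set (Fin n → ℂ)) : Prop :=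
  ∃ Ω : Set (Fin n → ℝ), Ω.Nonempty ∧ IsOpen Ω ∧ Convex ℝ Ω ∧ D = {z | reVec z ∈ Ω}

/-- The base `Re D` of a tube domain. -/
def tubeBase {n : ℕ} (D : Set (Fin n → ℂ)) : Set (Fin n → ℝ) := reVec '' D

/-- `φ` is (on the unit disc) a holomorphic map into `D`; the values of `φ` outside the disc play
no role. -/
def IsHolomorphicDisc {n : ℕ} (D : Set (Fin n → ℂ)) (φ : ℂ → Fin n → ℂ) : Prop :=
  DifferentiableOn ℂ φ (Metric.ball 0 1) ∧ MapsTo φ (Metric.ball 0 1) D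

/-- Tautness: the family of holomorphic maps from the unit disc to `D` is normal, i.e. each
sequence has a subsequence that either converges locally uniformly on the disc to a holomorphic
map into `D`, or is compactly divergent. -/
def IsTaut {n : ℕ} (D : Set (Fin n → ℂ)) : Prop :=
  ∀ f : ℕ → ℂ → Fin n → ℂ, (∀ k, IsHolomorphicDisc D (f k)) →
    ∃ s : ℕ → ℕ, StrictMono s ∧
      ((∃ g, IsHolomorphicDisc D g ∧
          TendstoLocallyUniformlyOn (fun k => f (s k)) g atTop (Metric.ball 0 1)) ∨
        ∀ K ⊆ Metric.ball (0 : ℂ) 1, IsCompact K → ∀ L ⊆ D, IsCompact L →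
          ∀ᶠ k in atTop, Disjoint (f (s k) '' K) L)

/-! ### Complex geodesics -/

/-- The Poincaré distance on the unit disc. -/
def poincareDist (a b : ℂ) : ℝ :=
  Real.artanh ‖(a - b) / (1 - (starRingEnd ℂ) b * a)‖

/-- The Carathéodory (pseudo)distance of `D`: the supremum of the Poincaré distances of
`f z` and `f w` over all holomorphic `f` from `D` to the unit disc. -/
def caratheodoryDist {n : ℕ} (D : Set (Fin n → ℂ)) (z w : Fin n → ℂ) : ENNReal :=
  ⨆ f ∈ {f : (Fin n → ℂ) → ℂ | DifferentiableOn ℂ f D ∧ MapsTo f D (Metric.ball 0 1)},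
    ENNReal.ofReal (poincareDist (f z) (f w))

/-- A complex geodesic for `D`: a holomorphic map from the unit disc to `D` which is an isometry
for the Poincaré distance of the disc and the Carathéodory (pseudo)distance of `D`. -/
def IsComplexGeodesic {n : ℕ} (D : Set (Fin n → ℂ)) (φ : ℂ → Fin n → ℂ) : Prop :=
  IsHolomorphicDisc D φ ∧
    ∀ a ∈ Metric.ball (0 : ℂ) 1, ∀ b ∈ Metric.ball (0 : ℂ) 1,
      caratheodoryDist D (φ a) (φ b) = ENNReal.ofReal (poincareDist a b)

/-! ### Boundary measures and radial limits -/

/-- The holomorphic function `f_σ(z) = (1/2π) ∫ (ζ + z)/(ζ - z) dσ(ζ)` on the unit disc defined by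
a real measure `σ` on the unit circle. -/
def herglotz (σ : SignedMeasure Circle) (z : ℂ) : ℂ :=
  (1 / (2 * Real.pi) : ℂ) * ∫ᵛ ζ : Circle, ((ζ : ℂ) + z) / ((ζ : ℂ) - z) ∂<•σ

/-- `μ = (μ₁, …, μₙ)` is the boundary measure of `φ`: on the unit disc each component of `φ` is
`f_{μⱼ} + i α` for a real constant `α`. -/
def IsBoundaryMeasure {n : ℕ} (φ : ℂ → Fin n → ℂ) (μ : Fin n → SignedMeasure Circle) : Prop :=
  ∀ j, ∃ α : ℝ, ∀ z ∈ Metric.ball (0 : ℂ) 1, φ z j = herglotz (μ j) z + Complex.I * α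

/-- `w` is the radial limit `φ*(ζ)` of `φ` at the point `ζ` of the unit circle. -/
def HasRadialLimit {n : ℕ} (φ : ℂ → Fin n → ℂ) (ζ : Circle) (w : Fin n → ℂ) : Prop :=
  Tendsto (fun r : ℝ => φ ((r : ℂ) * (ζ : ℂ))) (𝓝[<] 1) (𝓝 w)

/-! ### The map `h` -/

/-- `h(z) = ā z² + b z + a` for some `a ∈ ℂⁿ` and `b ∈ ℝⁿ`. -/
def IsSelfReciprocalQuadratic {n : ℕ} (h : ℂ → Fin n → ℂ) : Prop :=
  ∃ (a : Fin n → ℂ) (b : Fin n → ℝ), ∀ (z : ℂ) (j : Fin n),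
    h z j = (starRingEnd ℂ) (a j) * z ^ 2 + (b j : ℂ) * z + a j

/-- The vector `ζ̄ h(ζ)`, for `ζ` in the unit circle. For the maps `h` considered here it is real
(see `coe_circleVec`), hence it is defined as an element of `ℝⁿ`. -/
def circleVec {n : ℕ} (h : ℂ → Fin n → ℂ) (ζ : Circle) : Fin n → ℝ :=
  fun j => ((starRingEnd ℂ) (ζ : ℂ) * h ζ j).re

theorem coe_circleVec {n : ℕ} {h : ℂ → Fin n → ℂ} (hh : IsSelfReciprocalQuadratic h)
    (ζ : Circle) (j : Fin n) :
    (circleVec h ζ j : ℂ) = (starRingEnd ℂ) (ζ : ℂ) * h ζ j := by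
  obtain ⟨a, b, hab⟩ := hh
  rw [circleVec, ← Complex.conj_eq_iff_re]
  have h1 : (starRingEnd ℂ) (ζ : ℂ) * (ζ : ℂ) = 1 := by
    rw [← Complex.normSq_eq_conj_mul_self, Circle.normSq_coe, Complex.ofReal_one]
  rw [hab]
  simp only [map_mul, map_add, map_pow, Complex.conj_conj, Complex.conj_ofReal]
  linear_combination ((starRingEnd ℂ) (ζ : ℂ) * a j - (ζ : ℂ) * (starRingEnd ℂ) (a j)) * h1

/-- The real measure `ζ̄ h(ζ) • (Re z dℒ(ζ) - dμ(ζ))` on the unit circle, i.e.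
`∑ⱼ ζ̄ hⱼ(ζ) (Re zⱼ dℒ(ζ) - dμⱼ(ζ))`. -/
def pairingMeasure {n : ℕ} (h : ℂ → Fin n → ℂ) (μ : Fin n → SignedMeasure Circle)
    (z : Fin n → ℂ) : SignedMeasure Circle :=
  ∑ j, ((z j).re • circleLebesgueSigned - μ j).withDensity (fun ζ => circleVec h ζ j)
    (ContinuousLinearMap.lsmul ℝ ℝ)

/-- The conditions on `h` in the characterisation of complex geodesics of `D` through their
boundary measure `μ`: `h` is of the form `ā z² + b z + a`, is not identically zero, and the measure
`ζ̄ h(ζ) • (Re z dℒ(ζ) - dμ(ζ))` is negative for every `z ∈ D`. -/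
def IsGeodesicMultiplier {n : ℕ} (D : Set (Fin n → ℂ)) (μ : Fin n → SignedMeasure Circle)
    (h : ℂ → Fin n → ℂ) : Prop :=
  IsSelfReciprocalQuadratic h ∧ h ≠ 0 ∧ ∀ z ∈ D, pairingMeasure h μ z ≤ 0

/-! ### The sets `V` and `A` -/

/-- `V = {v ∈ ℝⁿ : ⟨Re z - p, v⟩ < 0 for all z ∈ D}`. -/
def outwardCone {n : ℕ} (D : Set (Fin n → ℂ)) (p : Fin n → ℝ) : Set (Fin n → ℝ) :=
  {v | ∀ z ∈ D, (reVec z - p) ⬝ᵥ v < 0}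

/-- `A = {ζ : ζ̄ h(ζ) ∈ int V}`. -/
def vertexSet {n : ℕ} (D : Set (Fin n → ℂ)) (p : Fin n → ℝ) (h : ℂ → Fin n → ℂ) : Set Circle :=
  {ζ | circleVec h ζ ∈ interior (outwardCone D p)}

end TubeGeodesic

end

open MeasureTheory Filter Topology Set

noncomputable section

namespace TubeGeodesic

/-! ### Signed measures through densities with respect to one positive measure -/

section SignedMeasures

variable {X : Type*} [MeasurableSpace X]

/-! Fix a finite positive measure `m` dominating arc length `ℒ` and all the `μ j`, and let `t ζ ∈
ℝⁿ` be the density of `μ - p ℒ` with respect to `m`. Everything reduces to showing `t = 0` almost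
everywhere on `A`, which follows from two opposite inequalities.

Since `φ` maps into `D`, for `v ∈ V` the harmonic function `⟨Re φ - p, v⟩` is negative on the disc.
It is the Poisson integral of `⟨t, v⟩ dm`, so `⟨t, v⟩ ≤ 0` almost everywhere
(`ae_nonpos_of_poisson_nonpos`), and by separability of `V` for all `v ∈ V` off a single null set.
Conversely, letting `Re z` tend to `p` in the condition on `h` gives `⟨ζ̄ h(ζ), t ζ⟩ ≥ 0` almost
everywhere.

If `ζ̄ h(ζ)` is interior to `V`, then `v = ζ̄ h(ζ) + ε t ζ` still lies in `V` for small `ε > 0`, and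
`0 ≥ ⟨v, t⟩ ≥ ε |t|²` forces `t ζ = 0` (`ae_excessDensity_eq_zero`). This is `μ = p ℒ` on `A`.

Finally, `A` is open, so near a point of `A` the measure `μ - p ℒ` vanishes. Its Herglotz integral
then has a radial limit there, whose real part is zero because the kernel is purely imaginary on the
circle. Only the contribution `p` of `p ℒ` remains in `Re φ*`. -/

theorem isFiniteMeasure_variation (σ : SignedMeasure X) : IsFiniteMeasure σ.variation := by
  rw [← SignedMeasure.totalVariation_eq_variation]
  unfold SignedMeasure.totalVariation
  infer_instance

/-- Both Jordan parts are absolutely continuous with respect to `m`, so each integral can be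
rewritten with its own density. This lets the later pointwise arguments run in a single measure
space. -/
theorem signedIntegral_eq_integral_rnDeriv_smul {E : Type*} [NormedAddCommGroup E]
    [NormedSpace ℝ E] (σ : SignedMeasure X) (m : Measure X) [SigmaFinite m]
    (hσ : σ.totalVariation ≪ m) {f : X → E} (hf : σ.Integrable f) :
    ∫ᵛ x, f x ∂<•σ = ∫ x, σ.rnDeriv m x • f x ∂m := by
  rw [VectorMeasure.Integrable, ← SignedMeasure.totalVariation_eq_variation,
    SignedMeasure.totalVariation, integrable_add_measure] at hf
  obtain ⟨hpos, hneg⟩ := hf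
  have hac : σ.toJordanDecomposition.posPart ≪ m :=
    (Measure.AbsolutelyContinuous.refl _).add_right _ |>.trans hσ
  have hac' : σ.toJordanDecomposition.negPart ≪ m := by
    refine Measure.AbsolutelyContinuous.trans ?_ hσ
    rw [SignedMeasure.totalVariation, add_comm]
    exact (Measure.AbsolutelyContinuous.refl _).add_right _
  conv_lhs => rw [← σ.toSignedMeasure_toJordanDecomposition]
  rw [JordanDecomposition.toSignedMeasure, VectorMeasure.integral_sub_vectorMeasure
    (by simpa [VectorMeasure.Integrable] using hpos)
    (by simpa [VectorMeasure.Integrable] using hneg),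
    VectorMeasure.integral_toSignedMeasure, VectorMeasure.integral_toSignedMeasure,
    ← integral_rnDeriv_smul hac, ← integral_rnDeriv_smul hac', ← integral_sub]
  · simp only [SignedMeasure.rnDeriv_def, sub_smul]
  · exact (integrable_rnDeriv_smul_iff hac).2 hpos
  · exact (integrable_rnDeriv_smul_iff hac').2 hneg

theorem signedMeasure_apply_eq_setIntegral_rnDeriv (σ : SignedMeasure X) (m : Measure X)
    [SigmaFinite m] (hσ : σ.totalVariation ≪ m) {s : Set X} (hs : MeasurableSet s) :
    σ s = ∫ x in s, σ.rnDeriv m x ∂m := by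
  conv_lhs => rw [← σ.withDensityᵥ_rnDeriv_eq m
    ((SignedMeasure.absolutelyContinuous_ennreal_iff _ _).2 (by simpa using hσ))]
  exact withDensityᵥ_apply (SignedMeasure.integrable_rnDeriv _ _) hs

theorem withDensity_apply_eq_setIntegral (σ : SignedMeasure X) (m : Measure X)
    [SigmaFinite m] (hσ : σ.totalVariation ≪ m) {f : X → ℝ} (hf : σ.Integrable f)
    {s : Set X} (hs : MeasurableSet s) :
    σ.withDensity f (ContinuousLinearMap.lsmul ℝ ℝ) s = ∫ x in s, f x * σ.rnDeriv m x ∂m := by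
  -- Real multiplication is symmetric, so the pairing in `withDensity` agrees with the flipped one
  -- behind `∂<•`.
  have hflip : ContinuousLinearMap.lsmul ℝ ℝ =
      (ContinuousLinearMap.lsmul ℝ ℝ : ℝ →L[ℝ] ℝ →L[ℝ] ℝ).flip := by
    ext; simp
  rw [VectorMeasure.withDensity_apply hf, ← VectorMeasure.integral_indicator hs, hflip,
    signedIntegral_eq_integral_rnDeriv_smul σ m hσ (hf.indicator hs), ← integral_indicator hs]
  congr 1 with x
  by_cases hx : x ∈ s <;> simp [hx, mul_comm]

/-- A function whose integrals against nonnegative continuous functions are nonpositive is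
almost everywhere nonpositive. -/
theorem ae_nonpos_of_forall_integral_continuous_mul_nonpos {X : Type*} [PseudoEMetricSpace X]
    [MeasurableSpace X] [BorelSpace X] {m : Measure X} [IsFiniteMeasure m] {t : X → ℝ}
    (ht : Integrable t m) (htm : Measurable t)
    (h : ∀ f : X → ℝ, Continuous f → (∀ x, 0 ≤ f x) → (∀ x, f x ≤ 1) → ∫ x, f x * t x ∂m ≤ 0) :
    t ≤ᵐ[m] 0 := by
  -- Thickened indicators are continuous and converge to the indicator of a closed set, so dominated
  -- convergence extends the hypothesis to closed sets.
  have hclosed : ∀ F, IsClosed F → ∫ x in F, t x ∂m ≤ 0 := by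
    intro F hF
    obtain ⟨δ, hδ⟩ : ∃ δ : ℕ → ℝ, (∀ k, 0 < δ k) ∧ Tendsto δ atTop (𝓝 0) :=
      ⟨fun k => 1 / ((k : ℝ) + 1), fun k => by positivity, tendsto_one_div_add_atTop_nhds_zero_nat⟩
    have hlim : Tendsto (fun k => ∫ x, (thickenedIndicator (hδ.1 k) F x : ℝ) * t x ∂m) atTop
        (𝓝 (∫ x, F.indicator t x ∂m)) := by
      refine tendsto_integral_of_dominated_convergence (fun x => ‖t x‖) (fun k => ?_) ht.norm
        (fun k => ae_of_all _ fun x => ?_) (ae_of_all _ fun x => ?_)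
      · exact ((NNReal.continuous_coe.comp
          (thickenedIndicator (hδ.1 k) F).continuous).aestronglyMeasurable).mul
            ht.aestronglyMeasurable
      · rw [norm_mul, Real.norm_of_nonneg (NNReal.coe_nonneg _)]
        refine mul_le_of_le_one_left (norm_nonneg _) ?_
        exact_mod_cast thickenedIndicator_le_one (hδ.1 k) F x
      · have h1 := (tendsto_pi_nhds.1 (thickenedIndicator_tendsto_indicator_closure hδ.1 hδ.2 F)) x
        rw [hF.closure_eq] at h1
        have h2 := ((NNReal.continuous_coe.tendsto _).comp h1).mul_const (t x)
        have h3 : F.indicator t x = (F.indicator (fun _ => (1 : NNReal)) x : NNReal) * t x := by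
          by_cases hx : x ∈ F
          · rw [indicator_of_mem hx, indicator_of_mem hx]; simp
          · rw [indicator_of_notMem hx, indicator_of_notMem hx]; simp
        rw [h3]
        exact h2
    rw [← integral_indicator hF.measurableSet]
    refine le_of_tendsto' hlim fun k => h _ ?_ (fun x => NNReal.coe_nonneg _) fun x => ?_
    · exact NNReal.continuous_coe.comp (thickenedIndicator (hδ.1 k) F).continuous
    · exact_mod_cast thickenedIndicator_le_one (hδ.1 k) F x
  by_contra hcon
  have hpos : 0 < m {x | 0 < t x} := by
    rw [pos_iff_ne_zero]
    intro h0
    refine hcon (ae_iff.2 ?_)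
    simpa using h0
  -- By inner regularity, if `t > 0` on a set of positive measure, then `t > 0` on a closed set of
  -- positive measure, against `hclosed`.
  obtain ⟨F, hFsub, hF, hFpos⟩ := (measurableSet_lt measurable_const htm).exists_lt_isClosed_of_ne_top
    (measure_ne_top m _) hpos
  have hnn : 0 ≤ᵐ[m.restrict F] t :=
    (ae_restrict_iff' hF.measurableSet).2 (ae_of_all _ fun x hx => (hFsub hx).le)
  have h0 : ∫ x in F, t x ∂m = 0 := le_antisymm (hclosed F hF) (integral_nonneg_of_ae hnn)
  rw [setIntegral_eq_zero_iff_of_nonneg_ae hnn ht.integrableOn, EventuallyEq,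
    ae_restrict_iff' hF.measurableSet] at h0
  refine hFpos.ne' (measure_mono_null (fun x hx => ?_) (ae_iff.1 h0))
  simpa [hx] using (hFsub hx).ne'

end SignedMeasures

/-! ### Herglotz and Poisson kernels; measures with nonpositive Poisson integral -/

section Poisson

theorem integral_circleLebesgue {E : Type*} [NormedAddCommGroup E] [NormedSpace ℝ E]
    {f : ℂ → E} (hf : Continuous fun ζ : Circle => f ζ) :
    ∫ ζ : Circle, f ζ ∂circleLebesgue = (2 * Real.pi) • Real.circleAverage f 0 1 := by
  have hper : Function.Periodic (fun θ : ℝ => f (Circle.exp θ)) (2 * Real.pi) := fun θ => by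
    simp only [Circle.exp_add_two_pi]
  have hshift := hper.intervalIntegral_add_eq (-Real.pi) 0
  rw [circleLebesgue, integral_map Circle.exp.continuous.measurable.aemeasurable
    hf.aestronglyMeasurable, Real.circleAverage_def, smul_inv_smul₀ Real.two_pi_pos.ne',
    ← intervalIntegral.integral_of_le (by linarith [Real.pi_pos])]
  rw [zero_add, show -Real.pi + 2 * Real.pi = Real.pi by ring] at hshift
  rw [hshift]
  congr 1 with θ
  simp [circleMap, Circle.coe_exp]

/-- The kernel `(ζ + z) / (ζ - z)` at a point `ζ` of the unit circle. -/
def herglotzKernel (z : ℂ) (ζ : Circle) : ℂ := ((ζ : ℂ) + z) / ((ζ : ℂ) - z)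

theorem circle_sub_ne_zero {z : ℂ} (hz : ‖z‖ < 1) (ζ : Circle) : (ζ : ℂ) - z ≠ 0 := by
  intro h
  rw [← sub_eq_zero.1 h, Circle.norm_coe] at hz
  exact lt_irrefl _ hz

theorem continuous_herglotzKernel {z : ℂ} (hz : ‖z‖ < 1) : Continuous (herglotzKernel z) := by
  unfold herglotzKernel
  exact (by fun_prop : Continuous fun ζ : Circle => (ζ : ℂ) + z).div
    (by fun_prop) (circle_sub_ne_zero hz)

theorem norm_mul_circle_lt_one {r : ℝ} (h0 : 0 ≤ r) (h1 : r < 1) (ξ : Circle) :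
    ‖(r : ℂ) * ξ‖ < 1 := by
  rw [norm_mul, Circle.norm_coe, mul_one, Complex.norm_real, Real.norm_of_nonneg h0]
  exact h1

theorem continuous_herglotzKernel_mul_circle {r : ℝ} (h0 : 0 ≤ r) (h1 : r < 1) :
    Continuous fun x : Circle × Circle => herglotzKernel ((r : ℂ) * x.1) x.2 := by
  unfold herglotzKernel
  exact (by fun_prop : Continuous fun x : Circle × Circle => (x.2 : ℂ) + (r : ℂ) * x.1).div
    (by fun_prop) fun x => circle_sub_ne_zero (norm_mul_circle_lt_one h0 h1 x.1) x.2

theorem re_herglotzKernel (z : ℂ) (ζ : Circle) :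
    (herglotzKernel z ζ).re = (1 - ‖z‖ ^ 2) / ‖(ζ : ℂ) - z‖ ^ 2 := by
  have h := congrFun (poissonKernel_eq_re_herglotzRieszKernel (c := 0) (w := z)) (ζ : ℂ)
  simp only [poissonKernel_def, herglotzRieszKernel_def, Function.comp_apply, sub_zero,
    Circle.norm_coe, one_pow] at h
  exact h.symm

theorem re_herglotzKernel_nonneg {z : ℂ} (hz : ‖z‖ < 1) (ζ : Circle) :
    0 ≤ (herglotzKernel z ζ).re := by
  rw [re_herglotzKernel]
  have : ‖z‖ ^ 2 ≤ 1 := pow_le_one₀ (norm_nonneg _) hz.le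
  exact div_nonneg (by linarith) (by positivity)

theorem norm_circle_sub_mul_circle (r : ℝ) (ξ ζ : Circle) :
    ‖(ζ : ℂ) - r * ξ‖ = ‖(ξ : ℂ) - r * ζ‖ := by
  rw [← sq_eq_sq₀ (norm_nonneg _) (norm_nonneg _), ← Complex.normSq_eq_norm_sq,
    ← Complex.normSq_eq_norm_sq, Complex.normSq_sub, Complex.normSq_sub]
  simp [Complex.normSq_mul]
  ring

theorem re_herglotzKernel_symm (r : ℝ) (ξ ζ : Circle) :
    (herglotzKernel (r * ξ) ζ).re = (herglotzKernel (r * ζ) ξ).re := by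
  rw [re_herglotzKernel, re_herglotzKernel, norm_circle_sub_mul_circle, norm_mul, norm_mul,
    Circle.norm_coe, Circle.norm_coe]

/-- The kernel equals `2 ζ / (ζ - z) - 1`, and Cauchy's formula for the constant `1` evaluates the
first term. -/
theorem integral_herglotzKernel {z : ℂ} (hz : ‖z‖ < 1) :
    ∫ ζ, herglotzKernel z ζ ∂circleLebesgue = 2 * Real.pi := by
  have hd : DiffContOnCl ℂ (fun _ : ℂ => (1 : ℂ)) (Metric.ball 0 |1|) := diffContOnCl_const
  have h := hd.circleAverage_smul_div (w := z) (by simpa using hz)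
  have hc : Continuous fun ζ : Circle => (ζ : ℂ) / (ζ - z) :=
    (by fun_prop : Continuous fun ζ : Circle => (ζ : ℂ)).div (by fun_prop) (circle_sub_ne_zero hz)
  have h2 := integral_circleLebesgue (f := fun ζ : ℂ => ζ / (ζ - z)) hc
  have h3 := integral_circleLebesgue (f := fun _ : ℂ => (1 : ℂ)) continuous_const
  simp only [sub_zero, smul_eq_mul, mul_one] at h
  rw [h] at h2
  rw [Real.circleAverage_const] at h3
  have hK : ∀ ζ : Circle, herglotzKernel z ζ = 2 * ((ζ : ℂ) / (ζ - z)) - 1 := fun ζ => by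
    have := circle_sub_ne_zero hz ζ
    rw [herglotzKernel]
    field_simp
    ring
  simp_rw [hK]
  have hi : Integrable (fun ζ : Circle => (ζ : ℂ) / (ζ - z)) circleLebesgue :=
    hc.integrable_of_hasCompactSupport (HasCompactSupport.of_compactSpace _)
  rw [integral_sub (hi.const_mul _) (integrable_const _), integral_const_mul, h2, h3]
  simp
  ring

theorem integral_poisson_smul {z : ℂ} (hz : ‖z‖ < 1) {f : ℂ → ℂ} (hf : Differentiable ℂ f) :
    ∫ ζ : Circle, (herglotzKernel z ζ).re • f ζ ∂circleLebesgue = (2 * Real.pi) * f z := by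
  have hd : DiffContOnCl ℂ f (Metric.ball 0 1) := hf.diffContOnCl
  have h := hd.circleAverage_re_herglotzRieszKernel_smul' (w := z) (by simpa using hz)
  have hc : Continuous fun ζ : Circle => (herglotzKernel z ζ).re • f ζ :=
    (Complex.continuous_re.comp (continuous_herglotzKernel hz)).smul
      (hf.continuous.comp (by fun_prop : Continuous fun ζ : Circle => (ζ : ℂ)))
  have h2 := integral_circleLebesgue (f := fun ζ : ℂ => ((ζ + z) / (ζ - z)).re • f ζ) hc
  simp only [sub_zero] at h
  rw [h] at h2
  simpa [herglotzKernel] using h2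

theorem integral_poisson {z : ℂ} (hz : ‖z‖ < 1) :
    ∫ ζ : Circle, (herglotzKernel z ζ).re ∂circleLebesgue = 2 * Real.pi := by
  have h := integral_poisson_smul hz (f := fun _ => 1) (differentiable_const _)
  simp only [Complex.real_smul, mul_one] at h
  have h2 : ((∫ ζ : Circle, (herglotzKernel z ζ).re ∂circleLebesgue : ℝ) : ℂ) =
      ((2 * Real.pi : ℝ) : ℂ) := by
    rw [← integral_complex_ofReal, h]
    push_cast
    rfl
  exact_mod_cast h2

theorem norm_circle_sub_sq (ζ η : Circle) :
    ‖(ζ : ℂ) - η‖ ^ 2 = (2 - 2 * ((ζ : ℂ) * (starRingEnd ℂ) η)).re := by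
  rw [← Complex.normSq_eq_norm_sq, Complex.normSq_sub]
  simp
  ring

/-- On the circle `‖ζ - η‖²` is the real part of the entire function `2 - 2 w η̄` at `w = ζ`, so the
Poisson formula evaluates it at `w = r η`. This second moment tends to `0` as `r → 1`, which
quantifies how the kernel concentrates at `η`. -/
theorem integral_poisson_mul_norm_sub_sq {r : ℝ} (h0 : 0 ≤ r) (h1 : r < 1) (η : Circle) :
    ∫ ζ : Circle, (herglotzKernel (r * η) ζ).re * ‖(ζ : ℂ) - η‖ ^ 2 ∂circleLebesgue =
      2 * Real.pi * (2 - 2 * r) := by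
  have hz := norm_mul_circle_lt_one h0 h1 η
  have h := integral_poisson_smul hz (f := fun w => 2 - 2 * (w * (starRingEnd ℂ) η))
    (by fun_prop)
  have hc : Continuous fun ζ : Circle =>
      (herglotzKernel (r * η) ζ).re • (2 - 2 * ((ζ : ℂ) * (starRingEnd ℂ) η)) :=
    (Complex.continuous_re.comp (continuous_herglotzKernel hz)).smul (by fun_prop)
  have hi := hc.integrable_of_hasCompactSupport (μ := circleLebesgue)
    (HasCompactSupport.of_compactSpace _)
  have h2 := Complex.reCLM.integral_comp_comm hi
  have h3 : (η : ℂ) * (starRingEnd ℂ) η = 1 := by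
    rw [Complex.mul_conj, Circle.normSq_coe, Complex.ofReal_one]
  rw [mul_assoc (r : ℂ), h3] at h
  rw [h] at h2
  have h4 : (2 * (Real.pi : ℂ) * (2 - 2 * (r * 1))) = ((2 * Real.pi * (2 - 2 * r) : ℝ) : ℂ) := by
    push_cast; ring
  rw [h4] at h2
  simp only [Complex.reCLM_apply, Complex.real_smul, Complex.re_ofReal_mul, Complex.ofReal_re] at h2
  simpa only [norm_circle_sub_sq] using h2

/-- Uniform continuity covers points closer than `δ`; for the others the quadratic term with `C = 1
/ δ²` is at least `1`, hence exceeds the oscillation of `f`. -/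
theorem exists_abs_sub_le_add_mul_norm_sub_sq {f : Circle → ℝ} (hf : Continuous f)
    (hf0 : ∀ ζ, 0 ≤ f ζ) (hf1 : ∀ ζ, f ζ ≤ 1) {ε : ℝ} (hε : 0 < ε) :
    ∃ C, 0 < C ∧ ∀ ζ η : Circle, |f ζ - f η| ≤ ε + C * ‖(ζ : ℂ) - η‖ ^ 2 := by
  obtain ⟨δ, hδ, h⟩ := Metric.uniformContinuous_iff.1
    (CompactSpace.uniformContinuous_of_continuous hf) ε hε
  refine ⟨1 / δ ^ 2, by positivity, fun ζ η => ?_⟩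
  by_cases hd : dist ζ η < δ
  · have := h hd
    rw [Real.dist_eq] at this
    have : 0 ≤ 1 / δ ^ 2 * ‖(ζ : ℂ) - η‖ ^ 2 := by positivity
    linarith
  · have hd' : δ ≤ ‖(ζ : ℂ) - η‖ := by
      rw [← dist_eq_norm]; exact not_lt.1 hd
    have h1 : 1 ≤ 1 / δ ^ 2 * ‖(ζ : ℂ) - η‖ ^ 2 := by
      rw [one_div_mul_eq_div, one_le_div (by positivity)]
      gcongr
    have h2 : |f ζ - f η| ≤ 1 := abs_le.2 ⟨by linarith [hf0 ζ, hf1 η], by linarith [hf0 η, hf1 ζ]⟩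
    linarith

/-- A Korovkin-type estimate: integrating the quadratic bound against the Poisson kernel needs only
its total mass and second moment. The symmetry of the kernel first moves the integration variable to
the boundary slot. -/
theorem abs_integral_poisson_mul_sub_le {f : Circle → ℝ} (hf : Continuous f) {ε C r : ℝ}
    (h0 : 0 ≤ r) (h1 : r < 1)
    (h : ∀ ζ η : Circle, |f ζ - f η| ≤ ε + C * ‖(ζ : ℂ) - η‖ ^ 2) (η : Circle) :
    |∫ ξ, f ξ * (herglotzKernel (r * ξ) η).re ∂circleLebesgue - 2 * Real.pi * f η| ≤
      2 * Real.pi * (ε + C * (2 - 2 * r)) := by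
  have hz := norm_mul_circle_lt_one h0 h1 η
  have hP : Continuous fun ζ : Circle => (herglotzKernel (r * η) ζ).re :=
    Complex.continuous_re.comp (continuous_herglotzKernel hz)
  have hint : ∀ {g : Circle → ℝ}, Continuous g → Integrable g circleLebesgue := fun hg =>
    hg.integrable_of_hasCompactSupport (HasCompactSupport.of_compactSpace _)
  have hN : Continuous fun ζ : Circle => ‖(ζ : ℂ) - η‖ ^ 2 := by fun_prop
  simp_rw [re_herglotzKernel_symm r _ η]
  rw [← integral_poisson hz, ← integral_mul_const, ← integral_sub (hint (by fun_prop))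
    (hint (by fun_prop))]
  calc _ ≤ ∫ ξ : Circle, |f ξ * (herglotzKernel (r * η) ξ).re
          - (herglotzKernel (r * η) ξ).re * f η| ∂circleLebesgue := abs_integral_le_integral_abs
    _ ≤ ∫ ξ : Circle, (ε * (herglotzKernel (r * η) ξ).re
          + C * ((herglotzKernel (r * η) ξ).re * ‖(ξ : ℂ) - η‖ ^ 2)) ∂circleLebesgue := by
        refine integral_mono (hint (by fun_prop)) (hint (by fun_prop)) fun ξ => ?_
        have hnn := re_herglotzKernel_nonneg hz ξ
        have := mul_le_mul_of_nonneg_left (h ξ η) hnn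
        rw [mul_comm (f ξ), ← mul_sub, abs_mul, abs_of_nonneg hnn]
        linarith
    _ = _ := by
        rw [integral_add (hint (by fun_prop)) (hint (by fun_prop)), integral_const_mul,
          integral_const_mul, integral_poisson_mul_norm_sub_sq h0 h1, integral_poisson hz]
        ring

/-- A density whose Poisson integral is nonpositive on the disc is almost everywhere
nonpositive. -/
theorem ae_nonpos_of_poisson_nonpos {m : Measure Circle} [IsFiniteMeasure m] {t : Circle → ℝ}
    (ht : Integrable t m) (htm : Measurable t)
    (h : ∀ z : ℂ, ‖z‖ < 1 → ∫ ζ, t ζ * (herglotzKernel z ζ).re ∂m ≤ 0) : t ≤ᵐ[m] 0 := by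
  refine ae_nonpos_of_forall_integral_continuous_mul_nonpos ht htm fun f hf hf0 hf1 => ?_
  refine le_of_forall_pos_le_add fun ε' hε' => ?_
  set T := ∫ ζ, |t ζ| ∂m with hT
  have hT0 : 0 ≤ T := integral_nonneg fun _ => abs_nonneg _
  set ε := ε' / (3 * (T + 1)) with hεdef
  have hε : 0 < ε := by positivity
  obtain ⟨C, hC, hfC⟩ := exists_abs_sub_le_add_mul_norm_sub_sq hf hf0 hf1 hε
  -- With this radius `C (2 - 2 r) = 2 ε r ≤ 2 ε`, so Poisson smoothing changes `f` by at most `3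
  -- ε`.
  set r := C / (C + ε) with hr
  have h0 : 0 ≤ r := by positivity
  have h1 : r < 1 := by rw [hr, div_lt_one (by positivity)]; linarith
  have hCr : C * (2 - 2 * r) ≤ 2 * ε := by
    have : C * (2 - 2 * r) = 2 * ε * r := by rw [hr]; field_simp; ring
    rw [this]; nlinarith
  have hK : Continuous fun x : Circle × Circle => (herglotzKernel ((r : ℂ) * x.1) x.2).re :=
    Complex.continuous_re.comp (continuous_herglotzKernel_mul_circle h0 h1)
  have hfK : Continuous fun x : Circle × Circle =>
      f x.1 * (herglotzKernel ((r : ℂ) * x.1) x.2).re := by fun_prop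
  obtain ⟨B, hB⟩ := isCompact_univ.exists_bound_of_continuousOn hfK.continuousOn
  have hprod : Integrable (fun x : Circle × Circle =>
      f x.1 * (herglotzKernel ((r : ℂ) * x.1) x.2).re * t x.2) (circleLebesgue.prod m) :=
    (ht.comp_snd circleLebesgue).bdd_mul hfK.aestronglyMeasurable
      (ae_of_all _ fun x => hB x (mem_univ x))
  -- Fubini transfers the smoothing from `f` to `t`: the smoothed test function integrated against
  -- `t` is an integral of `f ξ ≥ 0` times the Poisson integral of `t` at `r ξ`, which is
  -- nonpositive.
  have hswap := integral_integral_swap (f := fun ξ ζ : Circle =>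
    f ξ * (herglotzKernel ((r : ℂ) * ξ) ζ).re * t ζ) hprod
  have hneg : ∫ ξ, ∫ ζ, f ξ * (herglotzKernel ((r : ℂ) * ξ) ζ).re * t ζ ∂m ∂circleLebesgue ≤ 0 := by
    refine integral_nonpos fun ξ => ?_
    have : ∀ ζ, f ξ * (herglotzKernel ((r : ℂ) * ξ) ζ).re * t ζ =
        f ξ * (t ζ * (herglotzKernel ((r : ℂ) * ξ) ζ).re) := fun ζ => by ring
    simp_rw [this, integral_const_mul]
    exact mul_nonpos_of_nonneg_of_nonpos (hf0 ξ) (h _ (norm_mul_circle_lt_one h0 h1 ξ))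
  have hint := hprod.integral_prod_right
  rw [hswap] at hneg
  simp only [integral_mul_const] at hneg hint
  have hft : Integrable (fun ζ => f ζ * t ζ) m :=
    ht.bdd_mul hf.aestronglyMeasurable (c := 1) (ae_of_all _ fun ζ => by
      rw [Real.norm_of_nonneg (hf0 ζ)]; exact hf1 ζ)
  have hmain : 2 * Real.pi * ∫ ζ, f ζ * t ζ ∂m ≤ 2 * Real.pi * (3 * ε) * T := by
    rw [hT, ← integral_const_mul, ← integral_const_mul]
    calc _ ≤ ∫ ζ, ((∫ ξ, f ξ * (herglotzKernel (r * ξ) ζ).re ∂circleLebesgue) * t ζ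
          + 2 * Real.pi * (3 * ε) * |t ζ|) ∂m := by
          refine integral_mono (hft.const_mul _) (hint.add (ht.abs.const_mul _)) fun ζ => ?_
          have h3 := abs_integral_poisson_mul_sub_le hf h0 h1 hfC ζ
          have h4 : 2 * Real.pi * (ε + C * (2 - 2 * r)) ≤ 2 * Real.pi * (3 * ε) := by
            gcongr; linarith
          have h5 := mul_le_mul_of_nonneg_right (h3.trans h4) (abs_nonneg (t ζ))
          rw [← abs_mul] at h5
          have h6 := (abs_le.1 h5).1
          simp only
          linarith
      _ ≤ _ := by
          rw [integral_add hint (ht.abs.const_mul _)]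
          linarith
  have hpi := Real.two_pi_pos
  have h7 : ∫ ζ, f ζ * t ζ ∂m ≤ 3 * ε * T := by
    rw [mul_assoc (2 * Real.pi)] at hmain
    exact le_of_mul_le_mul_left hmain hpi
  have h8 : 3 * ε * T ≤ ε' := by
    have : 3 * ε * (T + 1) = ε' := by rw [hεdef]; field_simp
    nlinarith
  linarith

end Poisson

/-! ### Herglotz integrals in terms of the density of `σ - c ℒ` -/

section Densities

theorem continuous_integrable_signedMeasure {E : Type*} [NormedAddCommGroup E] {f : Circle → E}
    (hf : Continuous f) (σ : SignedMeasure Circle) : σ.Integrable f :=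
  have := isFiniteMeasure_variation σ
  hf.integrable_of_hasCompactSupport (HasCompactSupport.of_compactSpace _)

theorem totalVariation_absolutelyContinuous_iff_vectorMeasure {X : Type*} [MeasurableSpace X]
    (σ : SignedMeasure X) (m : Measure X) :
    σ.totalVariation ≪ m ↔ σ ≪ᵥ m.toENNRealVectorMeasure := by
  rw [SignedMeasure.absolutelyContinuous_ennreal_iff]
  simp

variable {m : Measure Circle}

/-- The density with respect to `m` of `σ - c ℒ`. -/
def excessDensity (m : Measure Circle) (σ : SignedMeasure Circle) (c : ℝ) (ζ : Circle) : ℝ :=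
  σ.rnDeriv m ζ - c * circleLebesgueSigned.rnDeriv m ζ

theorem measurable_excessDensity (σ : SignedMeasure Circle) (c : ℝ) :
    Measurable (excessDensity m σ c) :=
  (SignedMeasure.measurable_rnDeriv _ _).sub ((SignedMeasure.measurable_rnDeriv _ _).const_mul _)

theorem integrable_excessDensity (σ : SignedMeasure Circle) (c : ℝ) :
    Integrable (excessDensity m σ c) m :=
  (SignedMeasure.integrable_rnDeriv _ _).sub
    ((SignedMeasure.integrable_rnDeriv _ _).const_mul _)

theorem integrable_mul_continuous {f : Circle → ℝ} (hf : Integrable f m) {g : Circle → ℝ}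
    (hg : Continuous g) : Integrable (fun ζ => g ζ * f ζ) m := by
  obtain ⟨B, hB⟩ := isCompact_univ.exists_bound_of_continuousOn hg.continuousOn
  exact hf.bdd_mul hg.aestronglyMeasurable (ae_of_all _ fun x => hB x (mem_univ x))

theorem integrable_smul_herglotzKernel {f : Circle → ℝ} (hf : Integrable f m)
    {z : ℂ} (hz : ‖z‖ < 1) : Integrable (fun ζ => f ζ • herglotzKernel z ζ) m := by
  have hg := continuous_herglotzKernel hz
  obtain ⟨B, hB⟩ := isCompact_univ.exists_bound_of_continuousOn hg.continuousOn
  exact hf.smul_bdd B hg.aestronglyMeasurable (ae_of_all _ fun x => hB x (mem_univ x))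

variable [IsFiniteMeasure m]

theorem herglotz_eq_integral_rnDeriv {σ : SignedMeasure Circle} (hσ : σ.totalVariation ≪ m)
    {z : ℂ} (hz : ‖z‖ < 1) :
    herglotz σ z = (1 / (2 * Real.pi) : ℂ) * ∫ ζ, σ.rnDeriv m ζ • herglotzKernel z ζ ∂m := by
  rw [← signedIntegral_eq_integral_rnDeriv_smul σ m hσ
    (continuous_integrable_signedMeasure (continuous_herglotzKernel hz) σ)]
  rfl

theorem integral_rnDeriv_circleLebesgueSigned (hL : circleLebesgueSigned.totalVariation ≪ m)
    {z : ℂ} (hz : ‖z‖ < 1) :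
    ∫ ζ, circleLebesgueSigned.rnDeriv m ζ • herglotzKernel z ζ ∂m = 2 * Real.pi := by
  rw [← signedIntegral_eq_integral_rnDeriv_smul _ m hL
    (continuous_integrable_signedMeasure (continuous_herglotzKernel hz) _), circleLebesgueSigned,
    VectorMeasure.integral_toSignedMeasure, integral_herglotzKernel hz]

/-- The Herglotz integral of `ℒ` is identically `1`, so subtracting `c ℒ` from `σ` removes exactly
the constant `c`. -/
theorem herglotz_eq_add_integral_excessDensity (hL : circleLebesgueSigned.totalVariation ≪ m)
    {σ : SignedMeasure Circle} (hσ : σ.totalVariation ≪ m) (c : ℝ) {z : ℂ} (hz : ‖z‖ < 1) :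
    herglotz σ z = c + (1 / (2 * Real.pi) : ℂ) *
      ∫ ζ, excessDensity m σ c ζ • herglotzKernel z ζ ∂m := by
  have hi := integrable_smul_herglotzKernel (SignedMeasure.integrable_rnDeriv σ m) hz
  have hi' := integrable_smul_herglotzKernel
    (SignedMeasure.integrable_rnDeriv circleLebesgueSigned m) hz
  have hpi : (Real.pi : ℂ) ≠ 0 := by exact_mod_cast Real.pi_ne_zero
  rw [herglotz_eq_integral_rnDeriv hσ hz]
  simp only [excessDensity, sub_smul, mul_smul]
  rw [integral_sub hi (hi'.fun_smul c), integral_smul, integral_rnDeriv_circleLebesgueSigned hL hz,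
    Complex.real_smul]
  field_simp
  ring

theorem re_herglotz_sub (hL : circleLebesgueSigned.totalVariation ≪ m)
    {σ : SignedMeasure Circle} (hσ : σ.totalVariation ≪ m) (c : ℝ) {z : ℂ} (hz : ‖z‖ < 1) :
    ∫ ζ, excessDensity m σ c ζ * (herglotzKernel z ζ).re ∂m =
      2 * Real.pi * ((herglotz σ z).re - c) := by
  have h := Complex.reCLM.integral_comp_comm
    (integrable_smul_herglotzKernel (integrable_excessDensity (m := m) σ c) hz)
  simp only [Complex.reCLM_apply, Complex.real_smul, Complex.re_ofReal_mul] at h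
  have hc : (1 / (2 * Real.pi) : ℂ) = ((1 / (2 * Real.pi) : ℝ) : ℂ) := by push_cast; rfl
  rw [h, herglotz_eq_add_integral_excessDensity hL hσ c hz, Complex.add_re, Complex.ofReal_re, hc,
    Complex.re_ofReal_mul]
  simp only [Complex.real_smul]
  field_simp
  ring

end Densities

/-! ### The two opposite inequalities and the vanishing of the density on `A` -/

section AlmostEverywhere

variable {n : ℕ} {m : Measure Circle} [IsFiniteMeasure m] {D : Set (Fin n → ℂ)}
  {φ : ℂ → Fin n → ℂ} {μ : Fin n → SignedMeasure Circle} {h : ℂ → Fin n → ℂ} {p : Fin n → ℝ}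

theorem continuous_circleVec (hh : IsSelfReciprocalQuadratic h) : Continuous (circleVec h) := by
  obtain ⟨a, b, hab⟩ := hh
  unfold circleVec
  simp only [hab]
  refine continuous_pi fun j => ?_
  fun_prop

/-- The Poisson integral of this density at `z` is `2π ⟨Re φ(z) - p, v⟩`, which is negative because
`φ z ∈ D` and `v ∈ V`. -/
theorem ae_sum_mul_excessDensity_nonpos (hL : circleLebesgueSigned.totalVariation ≪ m)
    (hμm : ∀ j, (μ j).totalVariation ≪ m) (hmaps : MapsTo φ (Metric.ball 0 1) D)
    (hμ : IsBoundaryMeasure φ μ) {v : Fin n → ℝ} (hv : v ∈ outwardCone D p) :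
    ∀ᵐ ζ ∂m, ∑ j, v j * excessDensity m (μ j) (p j) ζ ≤ 0 := by
  have hti := fun j => (integrable_excessDensity (m := m) (μ j) (p j)).const_mul (v j)
  refine ae_nonpos_of_poisson_nonpos (integrable_finsetSum _ fun j _ => hti j)
    (Finset.measurable_fun_sum _ fun j _ => (measurable_excessDensity _ _).const_mul _)
    fun z hz => ?_
  have hK : Continuous fun ζ => (herglotzKernel z ζ).re :=
    Complex.continuous_re.comp (continuous_herglotzKernel hz)
  have hz' : z ∈ Metric.ball (0 : ℂ) 1 := by simpa using hz
  have hφ := hv (φ z) (hmaps hz')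
  have hre : ∀ j, (φ z j).re = (herglotz (μ j) z).re := fun j => by
    obtain ⟨α, hα⟩ := hμ j
    rw [hα z hz']
    simp
  have hsum : ∫ ζ, (∑ j, v j * excessDensity m (μ j) (p j) ζ) * (herglotzKernel z ζ).re ∂m =
      2 * Real.pi * ((reVec (φ z) - p) ⬝ᵥ v) := by
    simp_rw [Finset.sum_mul]
    rw [integral_finsetSum]
    · simp_rw [mul_assoc, integral_const_mul, re_herglotz_sub hL (hμm _) _ hz, dotProduct,
        Finset.mul_sum, Pi.sub_apply, reVec, hre]
      exact Finset.sum_congr rfl fun j _ => by ring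
    · intro j _
      simpa only [mul_comm] using integrable_mul_continuous (hti j) hK
  rw [hsum]
  exact mul_nonpos_of_nonneg_of_nonpos Real.two_pi_pos.le hφ.le

/-- The exceptional null set must not depend on `v`, since `v` will later be chosen depending on
`ζ`. A countable dense subset of `V` suffices, the inequality being closed in `v`. -/
theorem ae_forall_sum_mul_excessDensity_nonpos (hL : circleLebesgueSigned.totalVariation ≪ m)
    (hμm : ∀ j, (μ j).totalVariation ≪ m) (hmaps : MapsTo φ (Metric.ball 0 1) D)
    (hμ : IsBoundaryMeasure φ μ) :
    ∀ᵐ ζ ∂m, ∀ v ∈ outwardCone D p, ∑ j, v j * excessDensity m (μ j) (p j) ζ ≤ 0 := by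
  obtain ⟨Q, hQc, hQd⟩ := TopologicalSpace.exists_countable_dense (outwardCone D p)
  have h1 : ∀ᵐ ζ ∂m, ∀ v ∈ Q, ∑ j, (v : Fin n → ℝ) j * excessDensity m (μ j) (p j) ζ ≤ 0 :=
    (ae_ball_iff hQc).2 fun v _ => ae_sum_mul_excessDensity_nonpos hL hμm hmaps hμ v.2
  filter_upwards [h1] with ζ hζ v hv
  have hcl : IsClosed {v : outwardCone D p |
      ∑ j, (v : Fin n → ℝ) j * excessDensity m (μ j) (p j) ζ ≤ 0} :=
    isClosed_le (continuous_finsetSum _ fun j _ =>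
      ((continuous_apply j).comp continuous_subtype_val).mul_const _) continuous_const
  exact (hcl.closure_subset_iff.2 hζ) (hQd ⟨v, hv⟩)

theorem ae_sum_circleVec_mul_nonpos (hL : circleLebesgueSigned.totalVariation ≪ m)
    (hμm : ∀ j, (μ j).totalVariation ≪ m) (hh : IsSelfReciprocalQuadratic h) {z : Fin n → ℂ}
    (hz : pairingMeasure h μ z ≤ 0) :
    ∀ᵐ ζ ∂m, ∑ j, circleVec h ζ j *
      ((z j).re * circleLebesgueSigned.rnDeriv m ζ - (μ j).rnDeriv m ζ) ≤ 0 := by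
  set σ : Fin n → SignedMeasure Circle := fun j => (z j).re • circleLebesgueSigned - μ j with hσ
  have hσm : ∀ j, (σ j).totalVariation ≪ m := fun j => by
    rw [totalVariation_absolutelyContinuous_iff_vectorMeasure] at *
    exact (hL.smul).sub ((totalVariation_absolutelyContinuous_iff_vectorMeasure _ _).1 (hμm j))
  have hg : ∀ j, Continuous fun ζ => circleVec h ζ j := fun j =>
    (continuous_apply j).comp (continuous_circleVec hh)
  have hint := fun j => integrable_mul_continuous ((σ j).integrable_rnDeriv m) (hg j)
  have hle : ∀ᵐ ζ ∂m, 0 ≤ -∑ j, circleVec h ζ j * (σ j).rnDeriv m ζ := by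
    refine ae_nonneg_of_forall_setIntegral_nonneg
      (integrable_finsetSum _ fun j _ => hint j).neg fun E hE _ => ?_
    have hE0 := (VectorMeasure.le_iff.1 hz) E hE
    simp only [pairingMeasure] at hE0
    rw [integral_neg, integral_finsetSum _ fun j _ => (hint j).integrableOn, neg_nonneg]
    refine le_of_eq_of_le ?_ hE0
    rw [FunLike.coe_sum, Finset.sum_apply]
    exact Finset.sum_congr rfl fun j _ => (withDensity_apply_eq_setIntegral (σ j) m (hσm j)
      (continuous_integrable_signedMeasure (hg j) _) hE).symm
  have hrn : ∀ᵐ ζ ∂m, ∀ j, (σ j).rnDeriv m ζ =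
      (z j).re * circleLebesgueSigned.rnDeriv m ζ - (μ j).rnDeriv m ζ := by
    refine ae_all_iff.2 fun j => ?_
    filter_upwards [SignedMeasure.rnDeriv_sub ((z j).re • circleLebesgueSigned) (μ j) m,
      SignedMeasure.rnDeriv_smul circleLebesgueSigned m (z j).re] with ζ h1 h2
    rw [hσ]
    simp only [h1, Pi.sub_apply, h2, Pi.smul_apply, smul_eq_mul]
  filter_upwards [hle, hrn] with ζ h1 h2
  simp only [h2] at h1
  linarith

/-- A sequence in the base converging to `p` involves only countably many null sets, and the
inequalities for its members pass to the limit pointwise. -/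
theorem ae_sum_circleVec_mul_excessDensity_nonneg
    (hL : circleLebesgueSigned.totalVariation ≪ m) (hμm : ∀ j, (μ j).totalVariation ≪ m)
    (hh : IsGeodesicMultiplier D μ h) (hp : p ∈ closure (tubeBase D)) :
    ∀ᵐ ζ ∂m, 0 ≤ ∑ j, circleVec h ζ j * excessDensity m (μ j) (p j) ζ := by
  obtain ⟨x, hx, hxp⟩ := mem_closure_iff_seq_limit.1 hp
  choose z hzD hzx using hx
  have h1 : ∀ᵐ ζ ∂m, ∀ k, ∑ j, circleVec h ζ j *
      ((z k j).re * circleLebesgueSigned.rnDeriv m ζ - (μ j).rnDeriv m ζ) ≤ 0 :=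
    ae_all_iff.2 fun k => ae_sum_circleVec_mul_nonpos hL hμm hh.1 (hh.2.2 _ (hzD k))
  filter_upwards [h1] with ζ hζ
  have hlim : Tendsto (fun k => ∑ j, circleVec h ζ j *
      ((z k j).re * circleLebesgueSigned.rnDeriv m ζ - (μ j).rnDeriv m ζ)) atTop
      (𝓝 (∑ j, circleVec h ζ j *
        (p j * circleLebesgueSigned.rnDeriv m ζ - (μ j).rnDeriv m ζ))) := by
    refine tendsto_finsetSum _ fun j _ => ?_
    have hj : Tendsto (fun k => (z k j).re) atTop (𝓝 (p j)) := by
      have := (tendsto_pi_nhds.1 hxp) j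
      simpa only [← hzx, reVec] using this
    exact ((hj.mul_const _).sub_const _).const_mul _
  have h2 := le_of_tendsto' hlim hζ
  rw [← neg_nonpos, ← Finset.sum_neg_distrib]
  refine le_of_eq_of_le (Finset.sum_congr rfl fun j _ => ?_) h2
  rw [excessDensity]
  ring

/-- Interiority allows `ζ̄ h(ζ)` to be pushed slightly in the direction of the density `t` itself
without leaving `V`; pairing the result with `t` then bounds `ε |t|²` above by `0`. -/
theorem ae_excessDensity_eq_zero (hL : circleLebesgueSigned.totalVariation ≪ m)
    (hμm : ∀ j, (μ j).totalVariation ≪ m) (hmaps : MapsTo φ (Metric.ball 0 1) D)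
    (hμ : IsBoundaryMeasure φ μ) (hh : IsGeodesicMultiplier D μ h)
    (hp : p ∈ closure (tubeBase D)) :
    ∀ᵐ ζ ∂m, ζ ∈ vertexSet D p h → ∀ j, excessDensity m (μ j) (p j) ζ = 0 := by
  filter_upwards [ae_forall_sum_mul_excessDensity_nonpos (p := p) hL hμm hmaps hμ,
    ae_sum_circleVec_mul_excessDensity_nonneg hL hμm hh hp] with ζ h1 h2 hζ
  set t : Fin n → ℝ := fun j => excessDensity m (μ j) (p j) ζ with ht
  have hcont : Tendsto (fun ε : ℝ => circleVec h ζ + ε • t) (𝓝[>] 0) (𝓝 (circleVec h ζ)) := by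
    have : Continuous fun ε : ℝ => circleVec h ζ + ε • t := by fun_prop
    simpa using (this.tendsto 0).mono_left nhdsWithin_le_nhds
  obtain ⟨ε, hεV, hε⟩ := ((hcont.eventually (mem_interior_iff_mem_nhds.1 hζ)).and
    self_mem_nhdsWithin).exists
  have h3 := h1 _ hεV
  have h4 : ∑ j, (circleVec h ζ + ε • t) j * t j =
      ∑ j, circleVec h ζ j * t j + ε * ∑ j, t j * t j := by
    rw [Finset.mul_sum, ← Finset.sum_add_distrib]
    exact Finset.sum_congr rfl fun j _ => by simp; ring
  have h5 : ε * ∑ j, t j * t j ≤ 0 := by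
    change ∑ j, (circleVec h ζ + ε • t) j * t j ≤ 0 at h3
    change 0 ≤ ∑ j, circleVec h ζ j * t j at h2
    linarith
  have h6 : ∑ j, t j * t j = 0 := le_antisymm (nonpos_of_mul_nonpos_right h5 hε)
    (Finset.sum_nonneg fun j _ => mul_self_nonneg _)
  intro j
  exact mul_self_eq_zero.1
    ((Finset.sum_eq_zero_iff_of_nonneg fun j _ => mul_self_nonneg (t j)).1 h6 j (Finset.mem_univ j))

end AlmostEverywhere

/-! ### Radial limits of Herglotz integrals off the support -/

section RadialLimits

/-- The case `ζ = ξ` is included: there the quotient has denominator zero and takes the default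
value `0`. -/
theorem re_herglotzKernel_coe (ξ ζ : Circle) : (herglotzKernel ξ ζ).re = 0 := by
  rw [re_herglotzKernel, Circle.norm_coe]
  simp

/-- The kernel is singular only near `ξ`, where `t` vanishes almost everywhere; elsewhere it stays
bounded and dominated convergence applies. -/
theorem tendsto_integral_smul_herglotzKernel {m : Measure Circle} {t : Circle → ℝ}
    (ht : Integrable t m) {U : Set Circle} (hU : IsOpen U) (htU : ∀ᵐ ζ ∂m, ζ ∈ U → t ζ = 0)
    {ξ : Circle} (hξ : ξ ∈ U) :
    Tendsto (fun r : ℝ => ∫ ζ, t ζ • herglotzKernel (r * ξ) ζ ∂m) (𝓝[<] 1)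
      (𝓝 (∫ ζ, t ζ • herglotzKernel ξ ζ ∂m)) := by
  obtain ⟨δ, hδ, hδU⟩ := Metric.isOpen_iff.1 hU ξ hξ
  -- For `r ≥ 1 - δ / 2`, points at distance at least `δ` from `ξ` are at distance at least `δ / 2`
  -- from `r ξ`. The numerator is at most `2`, whence the bound `4 / δ`.
  have hr : ∀ᶠ r : ℝ in 𝓝[<] 1, r ∈ Ioo (max 0 (1 - δ / 2)) 1 :=
    Ioo_mem_nhdsLT (max_lt one_pos (by linarith))
  refine tendsto_integral_filter_of_dominated_convergence (fun ζ => 4 / δ * ‖t ζ‖) ?_ ?_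
    (ht.norm.const_mul _) ?_
  · filter_upwards [hr] with r hr
    exact ht.aestronglyMeasurable.smul (continuous_herglotzKernel
      (norm_mul_circle_lt_one ((le_max_left _ _).trans hr.1.le) hr.2 ξ)).aestronglyMeasurable
  · filter_upwards [hr] with r hr
    have h0 : 0 ≤ r := (le_max_left _ _).trans hr.1.le
    have hδr : 1 - δ / 2 ≤ r := (le_max_right _ _).trans hr.1.le
    filter_upwards [htU] with ζ hζ
    by_cases hζU : ζ ∈ U
    · simp [hζ hζU]
    have hdist : δ ≤ ‖(ζ : ℂ) - ξ‖ := by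
      rw [← dist_eq_norm]
      exact not_lt.1 fun hlt => hζU (hδU hlt)
    have hden : δ / 2 ≤ ‖(ζ : ℂ) - r * ξ‖ := by
      have h1 : ‖(ζ : ℂ) - ξ‖ ≤ ‖(ζ : ℂ) - r * ξ‖ + ‖(r : ℂ) * ξ - ξ‖ :=
        norm_sub_le_norm_sub_add_norm_sub _ _ _
      have h2 : ‖(r : ℂ) * ξ - ξ‖ = 1 - r := by
        rw [← sub_one_mul, norm_mul, Circle.norm_coe, mul_one, ← Complex.ofReal_one,
          ← Complex.ofReal_sub, Complex.norm_real, Real.norm_eq_abs, abs_sub_comm,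
          abs_of_nonneg (by linarith [hr.2])]
      linarith
    have hnum : ‖(ζ : ℂ) + r * ξ‖ ≤ 2 := by
      refine (norm_add_le _ _).trans ?_
      have := norm_mul_circle_lt_one h0 hr.2 ξ
      rw [Circle.norm_coe]
      linarith
    have hK : ‖herglotzKernel (r * ξ) ζ‖ ≤ 4 / δ := by
      rw [herglotzKernel, norm_div]
      calc _ ≤ 2 / (δ / 2) := by gcongr
        _ = 4 / δ := by field_simp; ring
    rw [norm_smul, mul_comm]
    gcongr
  · filter_upwards [htU] with ζ hζ
    by_cases hζU : ζ ∈ U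
    · simp [hζ hζU]
    have hne : (ζ : ℂ) - ξ ≠ 0 := fun h => hζU (by
      rwa [Circle.coe_injective (sub_eq_zero.1 h)])
    have hcont : ContinuousAt (fun r : ℝ => ((ζ : ℂ) + r * ξ) / (ζ - r * ξ)) 1 :=
      (by fun_prop : Continuous fun r : ℝ => (ζ : ℂ) + r * ξ).continuousAt.div
        (by fun_prop : Continuous fun r : ℝ => (ζ : ℂ) - r * ξ).continuousAt (by simpa using hne)
    have hlim := (hcont.tendsto.mono_left (nhdsWithin_le_nhds (s := Iio 1))).const_smul (t ζ)
    simpa [herglotzKernel] using hlim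

theorem re_integral_smul_herglotzKernel_coe {m : Measure Circle} (t : Circle → ℝ) (ξ : Circle) :
    (∫ ζ, t ζ • herglotzKernel ξ ζ ∂m).re = 0 := by
  have hK : ∀ ζ, t ζ • herglotzKernel ξ ζ =
      Complex.I * ((t ζ * (herglotzKernel ξ ζ).im : ℝ) : ℂ) := fun ζ => by
    apply Complex.ext <;> simp [re_herglotzKernel_coe]
  simp_rw [hK]
  rw [integral_const_mul, integral_complex_ofReal, Complex.I_mul_re, Complex.ofReal_im, neg_zero]

end RadialLimits

end TubeGeodesic

end

/-! ### The lemma itself -/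

theorem mainTheorem8 {n : ℕ} (D : Set (Fin n → ℂ))
    (hD : TubeGeodesic.IsConvexTube D) (hD_taut : TubeGeodesic.IsTaut D)
    (p : Fin n → ℝ) (hp : p ∈ frontier (TubeGeodesic.tubeBase D))
    (φ : ℂ → Fin n → ℂ) (hφ : TubeGeodesic.IsComplexGeodesic D φ)
    (μ : Fin n → SignedMeasure Circle) (hμ : TubeGeodesic.IsBoundaryMeasure φ μ)
    (h : ℂ → Fin n → ℂ) (hh : TubeGeodesic.IsGeodesicMultiplier D μ h) :
    MeasurableSet (TubeGeodesic.vertexSet D p h) ∧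
    (∀ j, (μ j).restrict (TubeGeodesic.vertexSet D p h) =
      p j • TubeGeodesic.circleLebesgueSigned.restrict (TubeGeodesic.vertexSet D p h)) ∧
    ∀ ζ ∈ TubeGeodesic.vertexSet D p h,
      ∃ w, TubeGeodesic.HasRadialLimit φ ζ w ∧ TubeGeodesic.reVec w = p := by
  open TubeGeodesic in
  have hopen : IsOpen (vertexSet D p h) :=
    isOpen_interior.preimage (continuous_circleVec hh.1)
  have hfin : ∀ σ : SignedMeasure Circle, IsFiniteMeasure σ.totalVariation := fun σ => by
    rw [SignedMeasure.totalVariation_eq_variation]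
    exact isFiniteMeasure_variation σ
  obtain ⟨m, hm, hL, hμm⟩ : ∃ m : Measure Circle, IsFiniteMeasure m ∧
      circleLebesgueSigned.totalVariation ≪ m ∧ ∀ j, (μ j).totalVariation ≪ m := by
    refine ⟨circleLebesgueSigned.totalVariation + Measure.sum fun j => (μ j).totalVariation,
      ?_, ?_, fun j => ?_⟩
    · rw [Measure.sum_fintype]
      infer_instance
    · exact (Measure.AbsolutelyContinuous.refl _).add_right _
    · rw [add_comm]
      exact (Measure.absolutelyContinuous_sum_right j
        (Measure.AbsolutelyContinuous.refl _)).add_right _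
  have hae := ae_excessDensity_eq_zero (p := p) hL hμm hφ.1.2 hμ hh (frontier_subset_closure hp)
  refine ⟨hopen.measurableSet, fun j => ?_, fun ξ hξ => ?_⟩
  · ext E hE
    rw [_root_.smul_apply, VectorMeasure.restrict_apply _ hopen.measurableSet hE,
      VectorMeasure.restrict_apply _ hopen.measurableSet hE,
      signedMeasure_apply_eq_setIntegral_rnDeriv _ m (hμm j) (hE.inter hopen.measurableSet),
      signedMeasure_apply_eq_setIntegral_rnDeriv _ m hL (hE.inter hopen.measurableSet),
      smul_eq_mul, ← integral_const_mul]
    refine setIntegral_congr_ae (hE.inter hopen.measurableSet) ?_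
    filter_upwards [hae] with ζ hζ hζE
    exact sub_eq_zero.1 (hζ hζE.2 j)
  · choose α hα using hμ
    -- The limit is the disc formula for `φ` with the kernel evaluated at the boundary point `ξ`;
    -- both the integral term and `i α` have real part zero.
    refine ⟨fun j => p j + (1 / (2 * Real.pi) : ℂ) *
      (∫ ζ, excessDensity m (μ j) (p j) ζ • herglotzKernel ξ ζ ∂m) + Complex.I * α j,
      tendsto_pi_nhds.2 fun j => ?_, funext fun j => ?_⟩
    · have hlim := tendsto_integral_smul_herglotzKernel (integrable_excessDensity (m := m) (μ j) (p j))
        hopen (hae.mono fun ζ hζ hζA => hζ hζA j) hξ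
      refine (((hlim.const_mul (1 / (2 * Real.pi) : ℂ)).const_add (p j : ℂ)).add_const
        (Complex.I * α j)).congr' ?_
      filter_upwards [Ioo_mem_nhdsLT (zero_lt_one' ℝ)] with r hr
      have hz := norm_mul_circle_lt_one hr.1.le hr.2 ξ
      rw [hα j _ (by simpa using hz), herglotz_eq_add_integral_excessDensity hL (hμm j) (p j) hz]
    · have hc : (1 / (2 * Real.pi) : ℂ) = ((1 / (2 * Real.pi) : ℝ) : ℂ) := by push_cast; rfl
      simp only [reVec]
      rw [hc, Complex.add_re, Complex.add_re, Complex.re_ofReal_mul,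
        re_integral_smul_herglotzKernel_coe]
      simp
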